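/- Let $L,\lambda,\mu,c>0$, $\Omega=(-L,L)$, $f(x)=\lambda x$ and $\alpha(x)=\mu|x|+c$ for $x\in\Omega$. Let $BV(\Omega)$ be the space of $u\in L^1(\Omega)$ whose distributional derivative $Du$ is a finite signed Borel measure on $\Omega$, and let $|Du|$ be the total variation measure of $Du$. Then the problem $$\min_{u\in BV(\Omega)}\ \frac12\int_\Omega (f-u)^2\,dx+\int_\Omega \alpha\,d|Du|$$ has a solution, unique up to equality almost everywhere in $\Omega$, and it is given (almost everywhere) by the following formulae. 1. If $\mu L+c<\frac{\lambda L^2}{2}$, then, with $x_{\mu,c}=L-\frac{\sqrt{2\lambda\mu L+2\lambda c}}{\lambda}$, $$u(x)=\begin{cases}-\lambda x_{\mu,c}-\mu, & x\in(-L,-x_{\mu,c}],\\ \lambda x-\mu, & x\in(-x_{\mu,c},0),\\ \lambda x+\mu, & x\in[0,x_{\mu,c}),\\ \lambda x_{\mu,c}+\mu, & x\in[x_{\mu,c},L).\end{cases}$$ 2. If $\mu L+c\ge\frac{\lambda L^2}{2}$ and $c<\frac{\lambda L^2}{2}$, then $$u(x)=\begin{cases}-\frac{\lambda L}{2}+\frac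 cL, & x\in(-L,0),\\ \frac{\lambda L}{2}-\frac cL, & x\in[0,L).\end{cases}$$ 3. If $c\ge\frac{\lambda L^2}{2}$, then $u(x)=0$ for $x\in(-L,L)$. -/

import Mathlib

open MeasureTheory Set
open scoped ContDiff ENNReal

noncomputable section

namespace WeightedTV

/-- The finite signed Borel measure `ν`, concentrated on the open set `Ω ⊆ ℝ`, represents the
distributional derivative `Du` in `Ω` of `u`:
`∫_Ω u φ' dx = - ∫ φ dν` for every test function `φ ∈ C_c^∞(Ω)`.
For a given `u` integrable on `Ω` there is at most one such `ν`. -/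
def IsDistribDeriv (Ω : Set ℝ) (u : ℝ → ℝ) (ν : SignedMeasure ℝ) : Prop :=
  ν.variation Ωᶜ = 0 ∧
    ∀ φ : ℝ → ℝ, ContDiff ℝ ∞ φ → HasCompactSupport φ → tsupport φ ⊆ Ω →
      ∫ x in Ω, u x * deriv φ x = - ∫ᵛ x, φ x ∂•ν

/-- `u ∈ BV(Ω)`: `u ∈ L¹(Ω)` and its distributional derivative in `Ω` is a finite signed measure.
Values of `u` outside `Ω` play no role. -/
def MemBV (Ω : Set ℝ) (u : ℝ → ℝ) : Prop :=
  IntegrableOn u Ω ∧ ∃ ν : SignedMeasure ℝ, IsDistribDeriv Ω u ν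

/-- The weighted total variation `∫_Ω α d|Du| ∈ [0, ∞]`, for a nonnegative weight `α`. For
`u ∈ BV(Ω)` the infimum runs over the single measure `ν = Du`; it is `∞` if `Du` is not a finite
measure. -/
def weightedTV (Ω : Set ℝ) (α u : ℝ → ℝ) : ℝ≥0∞ :=
  ⨅ (ν : SignedMeasure ℝ) (_ : IsDistribDeriv Ω u ν), ∫⁻ x, ENNReal.ofReal (α x) ∂ν.variation

/-- The objective `½ ∫_Ω (f - u)² dx + ∫_Ω α d|Du| ∈ [0, ∞]`. -/
def energy (Ω : Set ℝ) (f α u : ℝ → ℝ) : ℝ≥0∞ :=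
  (∫⁻ x in Ω, ENNReal.ofReal ((f x - u x) ^ 2 / 2)) + weightedTV Ω α u

/-- `u` is a solution of `min_{u ∈ BV(Ω)} ½ ∫_Ω (f - u)² dx + ∫_Ω α d|Du|`. -/
def IsSolution (Ω : Set ℝ) (f α u : ℝ → ℝ) : Prop :=
  MemBV Ω u ∧ ∀ w : ℝ → ℝ, MemBV Ω w → energy Ω f α u ≤ energy Ω f α w

end WeightedTV

end

/-! The proof is by convex duality. Let `p` be the primitive of `f - u` vanishing at `±L`, and
suppose `|p| ≤ α` and `p = -α` almost everywhere for the positive measure `Du`. Integration by parts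
gives `∫ u (f - u) = ∫ α d|Du|`, and `∫ v (f - u) = -∫ p dDv ≤ ∫ α d|Dv|` for every competitor `v`.
Expanding `(f - v)²` around `u` then shows that the energy of `v` exceeds that of `u` by at least `½
∫ (u - v)²`. This yields minimality and uniqueness together (`isSolution_iff_of_dual_certificate`).

The integration by parts (`IsDistribDeriv.integral_mul_eq_neg`) needs an approximation, since `p` is
not a test function.

All three formulae belong to one family: `lam * x` truncated at `±r`, plus a jump `2 * a` at `0`.
There `p = lam/2 * (|x| - r)₊² - (a|x| + b)`, and `p (±L) = 0` reads `lam/2 * (L - r)² = a L + b`.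
The cases are `a = mu, b = c`; then `r = 0, b = c`; then `r = a = 0`; this equation fixes the
remaining parameter. -/

open Filter Topology

/-! ### Approximation of mean-zero `L²` functions by derivatives of test functions -/

/-- Test functions supported in a bounded open interval are dense in `L²` of the interval. -/
theorem exists_contDiff_tsupport_subset_Ioo_eLpNorm_sub_le {L : ℝ} (hL : 0 < L) {g : ℝ → ℝ}
    (hg : MemLp g 2 (volume.restrict (Ioo (-L) L))) {ε : ℝ} (hε : 0 < ε) :
    ∃ ψ : ℝ → ℝ, ContDiff ℝ ∞ ψ ∧ HasCompactSupport ψ ∧ tsupport ψ ⊆ Ioo (-L) L ∧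
      eLpNorm (ψ - g) 2 (volume.restrict (Ioo (-L) L)) ≤ ENNReal.ofReal ε := by
  set μ := volume.restrict (Ioo (-L) L) with hμ
  obtain ⟨δ, hδ, hδg⟩ := hg.eLpNorm_indicator_le (by norm_num) (by norm_num) (half_pos hε)
  obtain ⟨r, hr0, hrL, hr⟩ : ∃ r, 0 < r ∧ r < L ∧ 2 * (L - r) ≤ δ := by
    refine ⟨max (L / 2) (L - δ / 2), by positivity, ?_, ?_⟩
    · exact max_lt (by linarith) (by linarith)
    · linarith [le_max_right (L / 2) (L - δ / 2)]
  let K : Set ℝ := Icc (-r) r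
  have hKm : MeasurableSet K := measurableSet_Icc
  have hKc : μ Kᶜ ≤ ENNReal.ofReal δ := by
    rw [hμ, Measure.restrict_apply hKm.compl]
    have hsub : Kᶜ ∩ Ioo (-L) L ⊆ Ioo (-L) (-r) ∪ Ioo r L := by
      rintro x ⟨hx, h1, h2⟩
      simp only [K, mem_compl_iff, mem_Icc, not_and_or, not_le] at hx
      rcases hx with h | h
      · exact Or.inl ⟨h1, h⟩
      · exact Or.inr ⟨h, h2⟩
    calc volume (Kᶜ ∩ Ioo (-L) L) ≤ volume (Ioo (-L) (-r)) + volume (Ioo r L) :=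
          (measure_mono hsub).trans (measure_union_le _ _)
      _ = ENNReal.ofReal (2 * (L - r)) := by
          rw [Real.volume_Ioo, Real.volume_Ioo, ← ENNReal.ofReal_add (by linarith) (by linarith)]
          congr 1; ring
      _ ≤ _ := ENNReal.ofReal_le_ofReal hr
  obtain ⟨h, -, hh, hhε⟩ := (hg.indicator hKm).exist_eLpNorm_sub_le (by norm_num) (by norm_num)
    (half_pos hε)
  let χ : ContDiffBump (0 : ℝ) := ⟨r, (r + L) / 2, hr0, by linarith⟩
  have hχ : tsupport χ ⊆ Ioo (-L) L := by
    rw [χ.tsupport_eq, Real.closedBall_eq_Icc]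
    rintro x ⟨h1, h2⟩
    simp only [χ] at h1 h2
    constructor <;> linarith
  refine ⟨fun x => χ x * h x, χ.contDiff.mul hh, χ.hasCompactSupport.mul_right,
    (tsupport_mul_subset_left).trans hχ, ?_⟩
  -- On `K` the cutoff is `1`; off `K` the target is `0` and `|χ h| ≤ |h|`. So the cutoff does not
  -- increase the error.
  have h1 : eLpNorm ((fun x => χ x * h x) - K.indicator g) 2 μ ≤ ENNReal.ofReal (ε / 2) := by
    refine le_trans ?_ hhε
    refine eLpNorm_mono fun x => ?_
    simp only [Pi.sub_apply]
    by_cases hx : x ∈ K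
    · have : χ x = 1 := χ.one_of_mem_closedBall (by
        rw [Real.closedBall_eq_Icc]; simpa [χ, K] using hx)
      rw [this, one_mul, norm_sub_rev]
    · rw [indicator_of_notMem hx]
      simp only [sub_zero, zero_sub, norm_neg, norm_mul]
      rw [Real.norm_of_nonneg χ.nonneg]
      exact mul_le_of_le_one_left (norm_nonneg _) χ.le_one
  have h2 : (fun x => χ x * h x) - g =
      ((fun x => χ x * h x) - K.indicator g) - Kᶜ.indicator g := by
    rw [← indicator_compl_add_self K g]
    ext x
    simp only [Pi.sub_apply, Pi.add_apply]
    by_cases hx : x ∈ K <;> simp [hx]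
  rw [h2]
  refine (eLpNorm_sub_le ?_ ?_ (by norm_num)).trans ?_
  · exact (χ.continuous.mul hh.continuous).aestronglyMeasurable.sub
      (hg.aestronglyMeasurable.indicator hKm)
  · exact hg.aestronglyMeasurable.indicator hKm.compl
  · calc _ ≤ ENNReal.ofReal (ε / 2) + ENNReal.ofReal (ε / 2) :=
          add_le_add h1 (hδg _ hKm.compl hKc)
      _ = _ := by rw [← ENNReal.ofReal_add (by linarith) (by linarith)]; simp

/-- On a finite measure space, convergence in `L²` implies convergence in `L¹`. -/
theorem tendsto_eLpNorm_one_of_tendsto_eLpNorm_two {μ : Measure ℝ} [IsFiniteMeasure μ]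
    {F : ℕ → ℝ → ℝ} (hF : ∀ n, AEStronglyMeasurable (F n) μ)
    (h : Tendsto (fun n => eLpNorm (F n) 2 μ) atTop (𝓝 0)) :
    Tendsto (fun n => eLpNorm (F n) 1 μ) atTop (𝓝 0) := by
  refine tendsto_of_tendsto_of_tendsto_of_le_of_le tendsto_const_nhds ?_ (fun _ => zero_le)
    (fun n => eLpNorm_le_eLpNorm_mul_rpow_measure_univ (q := 2) (by norm_num) (hF n))
  have := ENNReal.Tendsto.mul_const
    (b := μ univ ^ (1 / (1 : ℝ≥0∞).toReal - 1 / (2 : ℝ≥0∞).toReal))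
    h (Or.inr (ENNReal.rpow_ne_top_of_nonneg (by norm_num) (measure_ne_top _ _)))
  simpa using this

/-- An `L²` function of mean zero on a bounded open interval is an `L²` limit of test functions of
mean zero. -/
theorem exists_seq_contDiff_integral_eq_zero_tendsto {L : ℝ} (hL : 0 < L) {g : ℝ → ℝ}
    (hg : MemLp g 2 (volume.restrict (Ioo (-L) L))) (hg0 : ∫ x in Ioo (-L) L, g x = 0) :
    ∃ ψ : ℕ → ℝ → ℝ, (∀ n, ContDiff ℝ ∞ (ψ n)) ∧ (∀ n, HasCompactSupport (ψ n)) ∧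
      (∀ n, tsupport (ψ n) ⊆ Ioo (-L) L) ∧ (∀ n, ∫ x in Ioo (-L) L, ψ n x = 0) ∧
      Tendsto (fun n => eLpNorm (ψ n - g) 2 (volume.restrict (Ioo (-L) L))) atTop (𝓝 0) := by
  set μ := volume.restrict (Ioo (-L) L) with hμ
  have hex : ∀ n : ℕ, _ := fun n => exists_contDiff_tsupport_subset_Ioo_eLpNorm_sub_le hL hg
    (Nat.one_div_pos_of_nat (α := ℝ) (n := n))
  choose ψ h1 h2 h3 h4 using hex
  have h5 : Tendsto (fun n => eLpNorm (ψ n - g) 2 μ) atTop (𝓝 0) := by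
    refine tendsto_of_tendsto_of_tendsto_of_le_of_le tendsto_const_nhds ?_
      (fun _ => zero_le) h4
    simpa using ENNReal.tendsto_ofReal (tendsto_one_div_add_atTop_nhds_zero_nat (𝕜 := ℝ))
  have hψm : ∀ n, MemLp (ψ n) 2 μ := fun n =>
    ((h1 n).continuous.memLp_of_hasCompactSupport (h2 n)).restrict _
  have h6 : Tendsto (fun n => eLpNorm (ψ n - g) 1 μ) atTop (𝓝 0) :=
    tendsto_eLpNorm_one_of_tendsto_eLpNorm_two (fun n => ((hψm n).sub hg).aestronglyMeasurable) h5
  have h7 : Tendsto (fun n => ∫ x, ψ n x ∂μ) atTop (𝓝 0) := by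
    rw [← hg0]
    exact tendsto_integral_of_L1' g hg.aestronglyMeasurable
      (Eventually.of_forall fun n => (hψm n).integrable (by norm_num)) h6
  let χ : ContDiffBump (0 : ℝ) := ⟨L / 4, L / 2, by positivity, by linarith⟩
  have hχ : tsupport χ ⊆ Ioo (-L) L := by
    rw [χ.tsupport_eq, Real.closedBall_eq_Icc]
    rintro x ⟨h1, h2⟩
    simp only [χ] at h1 h2
    constructor <;> linarith
  let η : ℝ → ℝ := χ.normed volume
  have hη : tsupport η ⊆ Ioo (-L) L := by
    simp only [η]
    rwa [χ.tsupport_normed_eq, ← χ.tsupport_eq]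
  have hηm : MemLp η 2 μ :=
    (χ.continuous_normed.memLp_of_hasCompactSupport χ.hasCompactSupport_normed).restrict _
  have hη1 : ∫ x, η x ∂μ = 1 := by
    rw [hμ, setIntegral_eq_integral_of_forall_compl_eq_zero, χ.integral_normed]
    exact fun x hx => image_eq_zero_of_notMem_tsupport fun h => hx (hη h)
  -- The correction by the unit-mass bump `η` removes the mean. It is negligible in `L²` because the
  -- means tend to `∫ g = 0`.
  refine ⟨fun n => ψ n - (∫ x, ψ n x ∂μ) • η, fun n => ?_, fun n => ?_, fun n => ?_, fun n => ?_, ?_⟩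
  · exact (h1 n).sub (contDiff_const.smul χ.contDiff_normed)
  · exact (h2 n).sub (HasCompactSupport.smul_left χ.hasCompactSupport_normed)
  · refine (tsupport_sub _ _).trans (union_subset (h3 n) ?_)
    exact (tsupport_smul_subset_right (fun _ => ∫ x, ψ n x ∂μ) η).trans hη
  · simp only [Pi.sub_apply, Pi.smul_apply, smul_eq_mul]
    rw [integral_sub ((hψm n).integrable (by norm_num))
      ((hηm.integrable (by norm_num)).const_mul _), integral_const_mul, hη1]
    simp
  · have h8 : Tendsto (fun n => eLpNorm (ψ n - g) 2 μ +
        ‖∫ x, ψ n x ∂μ‖ₑ * eLpNorm η 2 μ) atTop (𝓝 0) := by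
      have h9 : Tendsto (fun n => ‖∫ x, ψ n x ∂μ‖ₑ) atTop (𝓝 0) := by
        simpa using h7.enorm
      simpa using h5.add (ENNReal.Tendsto.mul_const h9 (Or.inr hηm.eLpNorm_ne_top))
    refine tendsto_of_tendsto_of_tendsto_of_le_of_le tendsto_const_nhds h8 (fun _ => zero_le)
      fun n => ?_
    have : ψ n - (∫ x, ψ n x ∂μ) • η - g = (ψ n - g) - (∫ x, ψ n x ∂μ) • η := by abel
    rw [this, ← eLpNorm_const_smul]
    exact eLpNorm_sub_le ((hψm n).sub hg).aestronglyMeasurable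
      (hηm.const_smul _).aestronglyMeasurable (by norm_num)

/-- A test function of mean zero has a test function as primitive. -/
theorem contDiff_primitive_of_integral_eq_zero {L : ℝ} (hL : 0 < L) {ψ : ℝ → ℝ}
    (h1 : ContDiff ℝ ∞ ψ) (h2 : HasCompactSupport ψ) (h3 : tsupport ψ ⊆ Ioo (-L) L)
    (h4 : ∫ x in Ioo (-L) L, ψ x = 0) :
    ContDiff ℝ ∞ (fun x => ∫ t in (-L)..x, ψ t) ∧
      HasCompactSupport (fun x => ∫ t in (-L)..x, ψ t) ∧
      tsupport (fun x => ∫ t in (-L)..x, ψ t) ⊆ Ioo (-L) L ∧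
      deriv (fun x => ∫ t in (-L)..x, ψ t) = ψ := by
  have hd : ∀ x, HasDerivAt (fun x => ∫ t in (-L)..x, ψ t) (ψ x) x := fun x =>
    (h1.continuous.integral_hasStrictDerivAt (-L) x).hasDerivAt
  have hd' : deriv (fun x => ∫ t in (-L)..x, ψ t) = ψ := funext fun x => (hd x).deriv
  obtain ⟨r, hr, hψr⟩ : ∃ r, r < L ∧ ∀ x, r ≤ |x| → ψ x = 0 := by
    rcases (tsupport ψ).eq_empty_or_nonempty with he | hne
    · exact ⟨0, hL, fun x _ => image_eq_zero_of_notMem_tsupport (by simp [he])⟩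
    · obtain ⟨y, hy, hmax⟩ := h2.isCompact.exists_isMaxOn hne continuous_abs.continuousOn
      refine ⟨(|y| + L) / 2, ?_, fun x hx => image_eq_zero_of_notMem_tsupport fun hxs => ?_⟩
      · have := abs_lt.2 (h3 hy); linarith
      · have := abs_lt.2 (h3 hy); have := hmax hxs; simp only [mem_ofPred_eq] at this; linarith
  -- To the left of `-r` the integrand vanishes; to the right of `r` the primitive already equals
  -- the total integral, which is `0`.
  have hzero : ∀ x, x ∉ Icc (-r) r → ∫ t in (-L)..x, ψ t = 0 := by
    intro x hx
    rw [mem_Icc, not_and_or, not_le, not_le] at hx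
    rcases hx with hx | hx
    · refine intervalIntegral.integral_zero_ae (Eventually.of_forall fun t ht => hψr t ?_)
      have : t ≤ -r := by
        rcases (mem_uIoc.1 ht) with h | h <;> linarith
      rw [le_abs]; right; linarith
    · have hL' : ∫ t in (-L)..L, ψ t = 0 := by
        rw [intervalIntegral.integral_of_le (by linarith), integral_Ioc_eq_integral_Ioo, h4]
      have hxL : ∫ t in x..L, ψ t = 0 := by
        refine intervalIntegral.integral_zero_ae (Eventually.of_forall fun t ht => hψr t ?_)
        have : r ≤ t := by
          rcases (mem_uIoc.1 ht) with h | h <;> linarith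
        exact this.trans (le_abs_self _)
      rw [← intervalIntegral.integral_add_adjacent_intervals
        (h1.continuous.intervalIntegrable (-L) x) (h1.continuous.intervalIntegrable x L), hxL] at hL'
      simpa using hL'
  have hsub : tsupport (fun x => ∫ t in (-L)..x, ψ t) ⊆ Icc (-r) r :=
    closure_minimal (fun x hx => by_contra fun h => hx (hzero x h)) isClosed_Icc
  refine ⟨?_, HasCompactSupport.intro isCompact_Icc hzero,
    hsub.trans fun x hx => ⟨by linarith [hx.1], by linarith [hx.2]⟩, hd'⟩
  rw [contDiff_infty_iff_deriv, hd']
  exact ⟨fun x => (hd x).differentiableAt, h1⟩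

/-! ### Integrals against signed measures -/

instance (ν : SignedMeasure ℝ) : IsFiniteMeasure ν.variation := by
  rw [← SignedMeasure.totalVariation_eq_variation]
  infer_instance

theorem integral_smul_toSignedMeasure (m : Measure ℝ) [IsFiniteMeasure m] (f : ℝ → ℝ) :
    ∫ᵛ x, f x ∂•m.toSignedMeasure = ∫ x, f x ∂m := by
  have : (ContinuousLinearMap.lsmul ℝ ℝ : ℝ →L[ℝ] ℝ →L[ℝ] ℝ) =
      (ContinuousLinearMap.lsmul ℝ ℝ).flip := by ext; simp
  rw [this, VectorMeasure.integral_toSignedMeasure]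

theorem abs_integral_signedMeasure_le (ν : SignedMeasure ℝ) {p α : ℝ → ℝ}
    (h : ∀ᵐ x ∂ν.variation, |p x| ≤ α x)
    (hfin : ∫⁻ x, ENNReal.ofReal (α x) ∂ν.variation ≠ ⊤) :
    |∫ᵛ x, p x ∂•ν| ≤ (∫⁻ x, ENNReal.ofReal (α x) ∂ν.variation).toReal := by
  have h1 : ‖∫ᵛ x, p x ∂•ν‖ₑ ≤ ∫⁻ x, ENNReal.ofReal (α x) ∂ν.variation := by
    refine VectorMeasure.enorm_integral_le_lintegral_enorm_transpose.trans ?_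
    rw [VectorMeasure.variation_transpose_lsmul]
    refine lintegral_mono_ae (h.mono fun x hx => ?_)
    rw [Real.enorm_eq_ofReal_abs]
    exact ENNReal.ofReal_le_ofReal hx
  have := ENNReal.toReal_mono hfin h1
  simpa [toReal_enorm] using this

/-! ### Distributional derivatives and integration by parts -/

namespace WeightedTV

theorem IsDistribDeriv.congr_ae {Ω : Set ℝ} {u w : ℝ → ℝ} {ν : SignedMeasure ℝ}
    (h : IsDistribDeriv Ω u ν) (huw : u =ᵐ[volume.restrict Ω] w) : IsDistribDeriv Ω w ν := by
  refine ⟨h.1, fun φ h1 h2 h3 => ?_⟩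
  rw [← h.2 φ h1 h2 h3]
  exact integral_congr_ae (huw.mono fun x hx => by simp only [hx])

theorem IsDistribDeriv.ae_mem {Ω : Set ℝ} {u : ℝ → ℝ} {ν : SignedMeasure ℝ}
    (h : IsDistribDeriv Ω u ν) : ∀ᵐ x ∂ν.variation, x ∈ Ω := h.1

theorem MemBV.congr_ae {Ω : Set ℝ} {u w : ℝ → ℝ} (h : MemBV Ω u)
    (huw : u =ᵐ[volume.restrict Ω] w) : MemBV Ω w :=
  ⟨h.1.congr huw, h.2.imp fun _ hν => hν.congr_ae huw⟩

theorem energy_congr_ae {Ω : Set ℝ} {f α u w : ℝ → ℝ} (huw : u =ᵐ[volume.restrict Ω] w) :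
    energy Ω f α u = energy Ω f α w := by
  have h : ∀ ν, IsDistribDeriv Ω u ν ↔ IsDistribDeriv Ω w ν := fun ν =>
    ⟨fun h => h.congr_ae huw, fun h => h.congr_ae huw.symm⟩
  unfold energy weightedTV
  simp_rw [h]
  congr 1
  exact lintegral_congr_ae (huw.mono fun x hx => by simp only [hx])

/-- Integration by parts against the primitive of an `L²` function of mean zero. -/
theorem IsDistribDeriv.integral_mul_eq_neg {L : ℝ} (hL : 0 < L) {w g p : ℝ → ℝ}
    {ν : SignedMeasure ℝ} (hν : IsDistribDeriv (Ioo (-L) L) w ν)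
    (hw : MemLp w 2 (volume.restrict (Ioo (-L) L)))
    (hg : MemLp g 2 (volume.restrict (Ioo (-L) L))) (hg0 : ∫ x in Ioo (-L) L, g x = 0)
    (hp : ∀ x ∈ Ioo (-L) L, p x = ∫ t in (-L)..x, g t) :
    ∫ x in Ioo (-L) L, w x * g x = - ∫ᵛ x, p x ∂•ν := by
  obtain ⟨ψ, h1, h2, h3, h4, h5⟩ := exists_seq_contDiff_integral_eq_zero_tendsto hL hg hg0
  set μ := volume.restrict (Ioo (-L) L) with hμ
  have hψm : ∀ n, MemLp (ψ n) 2 μ := fun n =>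
    ((h1 n).continuous.memLp_of_hasCompactSupport (h2 n)).restrict _
  have hψ1 : ∀ n, Integrable (ψ n) μ := fun n => (hψm n).integrable (by norm_num)
  have hL1 : Tendsto (fun n => eLpNorm (ψ n - g) 1 μ) atTop (𝓝 0) :=
    tendsto_eLpNorm_one_of_tendsto_eLpNorm_two (fun n => ((hψm n).sub hg).aestronglyMeasurable) h5
  have hlim1 : Tendsto (fun n => ∫ x, w x * ψ n x ∂μ) atTop (𝓝 (∫ x, w x * g x ∂μ)) := by
    refine tendsto_integral_of_L1' (fun x => w x * g x)
      (hw.aestronglyMeasurable.mul hg.aestronglyMeasurable)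
      (Eventually.of_forall fun n => hw.integrable_mul (hψm n)) ?_
    have h6 : Tendsto (fun n => eLpNorm w 2 μ * eLpNorm (ψ n - g) 2 μ) atTop (𝓝 0) := by
      simpa using ENNReal.Tendsto.const_mul h5 (Or.inr hw.eLpNorm_ne_top)
    refine tendsto_of_tendsto_of_tendsto_of_le_of_le tendsto_const_nhds h6 (fun _ => zero_le)
      fun n => ?_
    have : ((fun x => w x * ψ n x) - fun x => w x * g x) = w • (ψ n - g) := by
      ext x; simp [mul_sub]
    simp only [this]
    exact eLpNorm_smul_le_mul_eLpNorm ((hψm n).sub hg).aestronglyMeasurable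
      hw.aestronglyMeasurable
  -- Dominated convergence for the finite measure `|ν|`: the primitives converge pointwise on the
  -- interval and are eventually bounded by `1 + ‖g‖₁`.
  have hlim2 : Tendsto (fun n => ∫ᵛ x, (∫ t in (-L)..x, ψ n t) ∂•ν) atTop
      (𝓝 (∫ᵛ x, p x ∂•ν)) := by
    refine VectorMeasure.tendsto_integral_filter_of_norm_le_const ?_ ?_ ?_
    · exact Eventually.of_forall fun n => (contDiff_primitive_of_integral_eq_zero hL (h1 n)
        (h2 n) (h3 n) (h4 n)).1.continuous.aestronglyMeasurable
    · have hb : ∀ᶠ n in atTop, eLpNorm (ψ n - g) 1 μ < 1 := hL1.eventually_lt_const (by simp)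
      refine ⟨1 + ∫ x, ‖g x‖ ∂μ, hb.mono fun n hn => hν.ae_mem.mono fun x hx => ?_⟩
      have hg1 : Integrable g μ := hg.integrable (by norm_num)
      have hd : Integrable (fun x => ψ n x - g x) μ := (hψ1 n).sub hg1
      have e1 : ∫ x, ‖ψ n x - g x‖ ∂μ ≤ 1 := by
        rw [integral_norm_eq_lintegral_enorm hd.aestronglyMeasurable]
        rw [eLpNorm_one_eq_lintegral_enorm] at hn
        simpa using ENNReal.toReal_mono (by simp) hn.le
      have e2 : ∫ x, ‖ψ n x‖ ∂μ ≤ ∫ x, ‖ψ n x - g x‖ ∂μ + ∫ x, ‖g x‖ ∂μ := by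
        rw [← integral_add hd.norm hg1.norm]
        exact integral_mono (hψ1 n).norm (hd.norm.add hg1.norm)
          fun x => norm_le_norm_sub_add (ψ n x) (g x)
      have e3 : ‖∫ t in (-L)..x, ψ n t‖ ≤ ∫ x, ‖ψ n x‖ ∂μ := by
        rw [intervalIntegral.integral_of_le hx.1.le]
        refine (norm_integral_le_integral_norm _).trans ?_
        exact setIntegral_mono_set (hψ1 n).norm (Eventually.of_forall fun _ => norm_nonneg _)
          (Ioc_subset_Ioo_right hx.2 |>.eventuallyLE)
      linarith
    · refine hν.ae_mem.mono fun x hx => ?_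
      rw [hp x hx]
      simp only [intervalIntegral.integral_of_le hx.1.le]
      have h7 := tendsto_setIntegral_of_L1' g hg.aestronglyMeasurable
        (Eventually.of_forall hψ1) hL1 (Ioc (-L) x)
      rw [hμ] at h7
      simp only [Measure.restrict_restrict measurableSet_Ioc] at h7
      rwa [inter_eq_left.2 (Ioc_subset_Ioo_right hx.2)] at h7
  refine tendsto_nhds_unique hlim1 ((hlim2.neg).congr fun n => ?_)
  obtain ⟨k1, k2, k3, k4⟩ := contDiff_primitive_of_integral_eq_zero hL (h1 n)
    (h2 n) (h3 n) (h4 n)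
  rw [← hν.2 _ k1 k2 k3, k4]

/-! ### Optimality from a dual certificate -/

/-- Characterisation of the solutions by a dual certificate `p`, a primitive of `f - u` vanishing on
the boundary with `|p| ≤ α`, and `p = -α` almost everywhere for the positive measure `Du`. -/
theorem isSolution_iff_of_dual_certificate {L : ℝ} (hL : 0 < L) {f α u p : ℝ → ℝ} {m : Measure ℝ}
    [IsFiniteMeasure m] (hf : MemLp f 2 (volume.restrict (Ioo (-L) L)))
    (hu : MemLp u 2 (volume.restrict (Ioo (-L) L))) (hα : Integrable α m) (hα0 : ∀ x, 0 ≤ α x)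
    (hm : IsDistribDeriv (Ioo (-L) L) u m.toSignedMeasure)
    (h0 : ∫ x in Ioo (-L) L, (f x - u x) = 0)
    (hp : ∀ x ∈ Ioo (-L) L, p x = ∫ t in (-L)..x, (f t - u t))
    (hpα : ∀ x ∈ Ioo (-L) L, |p x| ≤ α x) (hpm : ∀ᵐ x ∂m, p x = - α x) (w : ℝ → ℝ) :
    IsSolution (Ioo (-L) L) f α w ↔ w =ᵐ[volume.restrict (Ioo (-L) L)] u := by
  set μ := volume.restrict (Ioo (-L) L) with hμ
  have huBV : MemBV (Ioo (-L) L) u := ⟨hu.integrable (by norm_num), _, hm⟩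
  have hfu : MemLp (fun x => f x - u x) 2 μ := hf.sub hu
  have hsq : ∀ {v : ℝ → ℝ}, MemLp v 2 μ → ∫⁻ x, ENNReal.ofReal (v x ^ 2 / 2) ∂μ =
      ENNReal.ofReal (∫ x, v x ^ 2 / 2 ∂μ) := fun hv =>
    (ofReal_integral_eq_lintegral_ofReal (hv.integrable_sq.div_const 2)
      (Eventually.of_forall fun x => by positivity)).symm
  have hpu : ∫ x, u x * (f x - u x) ∂μ = ∫ x, α x ∂m := by
    rw [hm.integral_mul_eq_neg hL hu hfu h0 hp, integral_smul_toSignedMeasure, ← integral_neg]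
    exact integral_congr_ae (hpm.mono fun x hx => by simp only [hx, neg_neg])
  set A : ℝ := ∫ x, (f x - u x) ^ 2 / 2 ∂μ + ∫ x, α x ∂m with hA
  have hA0 : 0 ≤ A := add_nonneg (integral_nonneg fun x => by positivity) (integral_nonneg hα0)
  have hEu : energy (Ioo (-L) L) f α u ≤ ENNReal.ofReal A := by
    rw [hA, ENNReal.ofReal_add (integral_nonneg fun x => by positivity) (integral_nonneg hα0)]
    refine add_le_add (hsq hfu).le ?_
    refine (iInf₂_le _ hm).trans ?_
    rw [Measure.variation_toSignedMeasure,
      ofReal_integral_eq_lintegral_ofReal hα (Eventually.of_forall hα0)]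
  -- The quadratic gap `½ ∫ (u - v)²` gives minimality when dropped and uniqueness when kept.
  have hlower : ∀ v : ℝ → ℝ, MemBV (Ioo (-L) L) v → MemLp v 2 μ →
      ENNReal.ofReal (A + ∫ x, (u x - v x) ^ 2 / 2 ∂μ) ≤ energy (Ioo (-L) L) f α v := by
    intro v hvBV hv
    unfold energy weightedTV
    -- Moving the fidelity term to the left isolates the infimum over `ν`.
    rw [← tsub_le_iff_left]
    refine le_iInf₂ fun ν hν => ?_
    rw [tsub_le_iff_left]
    rcases eq_or_ne (∫⁻ x, ENNReal.ofReal (α x) ∂ν.variation) ⊤ with hinf | hfin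
    · rw [hinf]; simp
    have hb := abs_integral_signedMeasure_le ν
      (hν.ae_mem.mono fun x hx => hpα x hx) hfin
    have hpv := hν.integral_mul_eq_neg hL hv hfu h0 hp
    have hfv : MemLp (fun x => f x - v x) 2 μ := hf.sub hv
    have huv : MemLp (fun x => u x - v x) 2 μ := hu.sub hv
    rw [hsq hfv, ← ENNReal.ofReal_toReal hfin,
      ← ENNReal.ofReal_add (integral_nonneg fun x => by positivity) ENNReal.toReal_nonneg]
    refine ENNReal.ofReal_le_ofReal ?_
    have hexp : ∫ x, (f x - v x) ^ 2 / 2 ∂μ = ∫ x, (f x - u x) ^ 2 / 2 ∂μ +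
        ∫ x, (u x - v x) ^ 2 / 2 ∂μ + (∫ x, u x * (f x - u x) ∂μ - ∫ x, v x * (f x - u x) ∂μ) := by
      have i1 := hfu.integrable_sq.div_const 2
      have i2 := huv.integrable_sq.div_const 2
      have i3 : Integrable (fun x => u x * (f x - u x)) μ := hu.integrable_mul hfu
      have i4 : Integrable (fun x => v x * (f x - u x)) μ := hv.integrable_mul hfu
      rw [← integral_sub i3 i4, ← integral_add i1 i2,
        ← integral_add (by exact i1.add i2) (by exact i3.sub i4)]
      exact integral_congr_ae (Eventually.of_forall fun x => by
        ring)
    rw [hexp, hpu, hpv, hA]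
    linarith [(abs_le.1 hb).1]
  -- Membership in `BV` supplies only `L¹` here; finite energy together with `f ∈ L²` forces `v ∈
  -- L²`.
  have hL2 : ∀ v : ℝ → ℝ, MemBV (Ioo (-L) L) v → energy (Ioo (-L) L) f α v ≠ ⊤ →
      MemLp v 2 μ := by
    intro v hv hE
    have hfin : ∫⁻ x, ENNReal.ofReal ((f x - v x) ^ 2 / 2) ∂μ ≠ ⊤ :=
      (lt_of_le_of_lt le_self_add (lt_top_iff_ne_top.2 hE)).ne
    have hmeas : AEStronglyMeasurable (fun x => f x - v x) μ :=
      hf.aestronglyMeasurable.sub hv.1.aestronglyMeasurable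
    have hfv : MemLp (fun x => f x - v x) 2 μ := by
      rw [memLp_two_iff_integrable_sq hmeas]
      have : Integrable (fun x => (f x - v x) ^ 2 / 2) μ := by
        refine ⟨by simpa [div_eq_mul_inv] using (hmeas.pow 2).mul_const 2⁻¹, ?_⟩
        rw [hasFiniteIntegral_iff_ofReal (Eventually.of_forall fun x => by positivity)]
        exact lt_top_iff_ne_top.2 hfin
      simpa using this.mul_const 2
    convert hf.sub hfv using 1
    ext x
    simp
  constructor
  · rintro ⟨hw, hmin⟩
    have hle : energy (Ioo (-L) L) f α w ≤ ENNReal.ofReal A := (hmin u huBV).trans hEu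
    have hwL2 := hL2 w hw (ne_top_of_le_ne_top ENNReal.ofReal_ne_top hle)
    have h1 := (ENNReal.ofReal_le_ofReal_iff hA0).1 ((hlower w hw hwL2).trans hle)
    have huw : MemLp (fun x => u x - w x) 2 μ := hu.sub hwL2
    have h2 : ∫ x, (u x - w x) ^ 2 / 2 ∂μ = 0 :=
      le_antisymm (by linarith) (integral_nonneg fun x => by positivity)
    rw [integral_eq_zero_iff_of_nonneg (fun x => by positivity)
      (huw.integrable_sq.div_const 2)] at h2
    filter_upwards [h2] with x hx
    have : (u x - w x) ^ 2 = 0 := by simpa using hx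
    linarith [pow_eq_zero_iff (two_ne_zero) |>.1 this]
  · intro hwu
    refine ⟨huBV.congr_ae hwu.symm, fun v hv => ?_⟩
    rw [energy_congr_ae hwu]
    by_cases hE : energy (Ioo (-L) L) f α v = ⊤
    · simp [hE]
    refine hEu.trans ((ENNReal.ofReal_le_ofReal ?_).trans (hlower v hv (hL2 v hv hE)))
    linarith [integral_nonneg (μ := μ) (f := fun x => (u x - v x) ^ 2 / 2)
      fun x => by positivity]

/-! ### The family of candidates and its dual certificates -/

/-- The truncation of `x ↦ lam * x` at `±r`, with an additional jump of height `2 * a` at `0`. -/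
noncomputable def truncJump (lam a r x : ℝ) : ℝ :=
  lam * max (-r) (min x r) + a * (if x < 0 then -1 else 1)

/-- The primitive of `x ↦ lam * x - truncJump lam a r x` with value `-b` at `0`. -/
noncomputable def truncJumpDual (lam a b r x : ℝ) : ℝ :=
  lam / 2 * max (|x| - r) 0 ^ 2 - (a * |x| + b)

/-- The distributional derivative of `truncJump lam a r`. -/
noncomputable def truncJumpDeriv (lam a r : ℝ) : Measure ℝ :=
  ENNReal.ofReal lam • volume.restrict (Ioo (-r) r) + ENNReal.ofReal (2 * a) • Measure.dirac 0

instance (lam a r : ℝ) : IsFiniteMeasure (truncJumpDeriv lam a r) := by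
  unfold truncJumpDeriv
  have := Measure.smul_finite (volume.restrict (Ioo (-r) r)) (ENNReal.ofReal_ne_top (r := lam))
  have := Measure.smul_finite (Measure.dirac (0 : ℝ)) (ENNReal.ofReal_ne_top (r := 2 * a))
  infer_instance

variable {lam a b r : ℝ}

/-- The atom at `0` is absent when `a = 0` and the interval is empty when `r = 0`, so degenerate
parameters impose fewer conditions. -/
theorem ae_truncJumpDeriv {P : ℝ → Prop} (h : ∀ x ∈ Ioo (-r) r, P x) (h0 : 0 < a → P 0) :
    ∀ᵐ x ∂truncJumpDeriv lam a r, P x := by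
  unfold truncJumpDeriv
  rw [ae_add_measure_iff]
  constructor
  · exact Measure.ae_smul_measure ((ae_restrict_mem measurableSet_Ioo).mono h) _
  · rcases lt_or_ge 0 a with ha | ha
    · refine Measure.ae_smul_measure ?_ _
      rw [ae_dirac_eq]
      exact h0 ha
    · rw [ENNReal.ofReal_of_nonpos (by linarith)]
      simp

theorem integral_truncJumpDeriv (hlam : 0 ≤ lam) (ha : 0 ≤ a) {φ : ℝ → ℝ} (hφ : Continuous φ) :
    ∫ x, φ x ∂truncJumpDeriv lam a r = lam * (∫ x in Ioo (-r) r, φ x) + 2 * a * φ 0 := by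
  unfold truncJumpDeriv
  rw [integral_add_measure, integral_smul_measure, integral_smul_measure, integral_dirac,
    ENNReal.toReal_ofReal hlam, ENNReal.toReal_ofReal (by positivity), smul_eq_mul, smul_eq_mul]
  · exact ((hφ.integrableOn_Icc (a := -r) (b := r)).mono_set Ioo_subset_Icc_self).smul_measure
      ENNReal.ofReal_ne_top
  · exact (integrable_dirac (by simp)).smul_measure ENNReal.ofReal_ne_top

theorem measurable_truncJump : Measurable (truncJump lam a r) := by
  unfold truncJump
  refine Measurable.add (by fun_prop) (Measurable.const_mul ?_ _)
  exact Measurable.ite measurableSet_Iio measurable_const measurable_const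

theorem abs_truncJump_le (hlam : 0 ≤ lam) (ha : 0 ≤ a) (hr : 0 ≤ r) (x : ℝ) :
    |truncJump lam a r x| ≤ lam * r + a := by
  unfold truncJump
  refine (abs_add_le _ _).trans (add_le_add ?_ ?_)
  · rw [abs_mul, abs_of_nonneg hlam]
    refine mul_le_mul_of_nonneg_left ?_ hlam
    rw [abs_le]
    exact ⟨le_max_left _ _, max_le (by linarith) (min_le_right _ _)⟩
  · rw [abs_mul, abs_of_nonneg ha]
    split_ifs <;> simp

theorem memLp_truncJump (hlam : 0 ≤ lam) (ha : 0 ≤ a) (hr : 0 ≤ r) {μ : Measure ℝ}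
    [IsFiniteMeasure μ] {p : ℝ≥0∞} : MemLp (truncJump lam a r) p μ :=
  MemLp.of_bound measurable_truncJump.aestronglyMeasurable _
    (Eventually.of_forall fun x => abs_truncJump_le hlam ha hr x)

/-- Right derivatives exist at the kinks `±r` too, so no exceptional points arise; the half-open
`Ico` records their values there. -/
theorem hasDerivWithinAt_clamp (hr : 0 ≤ r) (x : ℝ) :
    HasDerivWithinAt (fun x => max (-r) (min x r)) ((Ico (-r) r).indicator 1 x) (Ioi x) x := by
  rcases lt_or_ge x (-r) with h1 | h1
  · rw [indicator_of_notMem (fun h => by linarith [h.1])]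
    refine ((hasDerivAt_const x (-r)).congr_of_eventuallyEq ?_).hasDerivWithinAt
    filter_upwards [Iio_mem_nhds h1] with y hy
    rw [max_eq_left ((min_le_left _ _).trans (le_of_lt hy))]
  rcases lt_or_ge x r with h2 | h2
  · rw [indicator_of_mem (show x ∈ Ico (-r) r from ⟨h1, h2⟩)]
    have hx : ∀ y, -r ≤ y → y < r → max (-r) (min y r) = y := fun y hy hy' => by
      rw [min_eq_left hy'.le, max_eq_right hy]
    refine (hasDerivAt_id x).hasDerivWithinAt.congr_of_eventuallyEq ?_ (hx x h1 h2)
    filter_upwards [self_mem_nhdsWithin, mem_nhdsWithin_of_mem_nhds (Iio_mem_nhds h2)] with y hy hy'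
    exact hx y (h1.trans (le_of_lt hy)) hy'
  · rw [indicator_of_notMem (fun h => by linarith [h.2])]
    have hx : ∀ y, r ≤ y → max (-r) (min y r) = r := fun y hy => by
      rw [min_eq_right hy, max_eq_right (by linarith)]
    exact (hasDerivWithinAt_const x _ r).congr (fun y hy => hx y (h2.trans (le_of_lt hy)))
      (hx x h2)

/-- The clamp is integrated by parts over the whole interval. The sign is treated on each half
separately, and each half contributes `-φ 0`, whence the atom of mass `2 * a`. -/
theorem isDistribDeriv_truncJump {L : ℝ} (hlam : 0 ≤ lam) (ha : 0 ≤ a) (hr : 0 ≤ r) (hrL : r < L) :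
    IsDistribDeriv (Ioo (-L) L) (truncJump lam a r) (truncJumpDeriv lam a r).toSignedMeasure := by
  have hL : 0 < L := hr.trans_lt hrL
  refine ⟨?_, fun φ h1 h2 h3 => ?_⟩
  · rw [Measure.variation_toSignedMeasure]
    exact ae_truncJumpDeriv (P := (· ∈ Ioo (-L) L))
      (fun x hx => ⟨by linarith [hx.1], by linarith [hx.2]⟩) fun _ => ⟨by linarith, hL⟩
  rw [integral_smul_toSignedMeasure, integral_truncJumpDeriv hlam ha h1.continuous]
  have hφL : φ L = 0 := image_eq_zero_of_notMem_tsupport fun h => lt_irrefl _ (h3 h).2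
  have hφL' : φ (-L) = 0 := image_eq_zero_of_notMem_tsupport fun h => lt_irrefl _ (h3 h).1
  have hφd : Differentiable ℝ φ := h1.differentiable (by simp)
  have hφ' : Continuous (deriv φ) := h1.continuous_deriv (by simp)
  have hind : IntervalIntegrable ((Ico (-r) r).indicator (1 : ℝ → ℝ)) volume (-L) L := by
    rw [intervalIntegrable_iff]
    exact ((integrable_indicator_iff measurableSet_Ico).2 (integrableOn_const (by simp))).integrableOn
  have hclamp : ∫ x in (-L)..L, max (-r) (min x r) * deriv φ x = -∫ x in Ioo (-r) r, φ x := by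
    rw [intervalIntegral.integral_mul_deriv_eq_deriv_mul_of_hasDeriv_right (by fun_prop)
      h1.continuous.continuousOn (fun x _ => hasDerivWithinAt_clamp hr x)
      (fun x _ => (hφd x).hasDerivAt.hasDerivWithinAt) hind (hφ'.intervalIntegrable _ _),
      hφL, hφL', intervalIntegral.integral_of_le (by linarith)]
    have : (fun x => (Ico (-r) r).indicator (1 : ℝ → ℝ) x * φ x) = (Ico (-r) r).indicator φ := by
      ext x
      by_cases hx : x ∈ Ico (-r) r <;> simp [hx]
    rw [this, setIntegral_indicator measurableSet_Ico,
      inter_eq_right.2 (show Ico (-r) r ⊆ Ioc (-L) L from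
        fun x hx => ⟨by linarith [hx.1], by linarith [hx.2]⟩),
      integral_Ico_eq_integral_Ioo]
    simp
  have hneg : ∫ x in (-L)..0, (if x < 0 then -1 else 1) * deriv φ x = -φ 0 := by
    have : ∫ x in (-L)..0, (if x < 0 then -1 else 1) * deriv φ x = ∫ x in (-L)..0, -deriv φ x := by
      refine intervalIntegral.integral_congr_ae ?_
      filter_upwards [compl_mem_ae_iff.2 (measure_singleton (μ := volume) (0 : ℝ))] with x hx hx'
      rw [uIoc_of_le (by linarith)] at hx'
      rw [if_pos (lt_of_le_of_ne hx'.2 hx)]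
      ring
    rw [this, intervalIntegral.integral_neg, intervalIntegral.integral_deriv_eq_sub
      (fun x _ => hφd x) (hφ'.intervalIntegrable _ _), hφL']
    ring
  have hpos : ∫ x in (0)..L, (if x < 0 then -1 else 1) * deriv φ x = -φ 0 := by
    have : ∫ x in (0)..L, (if x < 0 then -1 else 1) * deriv φ x = ∫ x in (0)..L, deriv φ x := by
      refine intervalIntegral.integral_congr fun x hx => ?_
      rw [uIcc_of_le hL.le] at hx
      simp [not_lt.2 hx.1]
    rw [this, intervalIntegral.integral_deriv_eq_sub
      (fun x _ => hφd x) (hφ'.intervalIntegrable _ _), hφL]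
    ring
  have hsgn : ∀ s t, IntervalIntegrable (fun x => (if x < 0 then -1 else 1) * deriv φ x)
      volume s t := fun s t => by
    refine (hφ'.intervalIntegrable s t).mono_fun ?_ (Eventually.of_forall fun x => ?_)
    · exact ((Measurable.ite measurableSet_Iio measurable_const measurable_const).mul
        hφ'.measurable).aestronglyMeasurable
    · simp only [norm_mul]
      split_ifs <;> simp
  rw [← integral_Ioc_eq_integral_Ioo, ← intervalIntegral.integral_of_le (by linarith)]
  have hsplit : ∀ x, truncJump lam a r x * deriv φ x =
      lam * (max (-r) (min x r) * deriv φ x) + a * ((if x < 0 then -1 else 1) * deriv φ x) :=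
    fun x => by unfold truncJump; ring
  simp only [hsplit]
  rw [intervalIntegral.integral_add, intervalIntegral.integral_const_mul,
    intervalIntegral.integral_const_mul, hclamp,
    ← intervalIntegral.integral_add_adjacent_intervals (hsgn (-L) 0) (hsgn 0 L), hneg, hpos]
  · ring
  · exact Continuous.intervalIntegrable (by fun_prop) _ _
  · exact (hsgn _ _).const_mul _

theorem hasDerivWithinAt_truncJumpDual (hr : 0 ≤ r) (x : ℝ) :
    HasDerivWithinAt (truncJumpDual lam a b r) (lam * x - truncJump lam a r x) (Ioi x) x := by
  -- One computation for all four branches: `s` is the sign of `x`, and `k` is `1` or `0` as the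
  -- square term is on or off.
  have key : ∀ (s k : ℝ), s ^ 2 = 1 → HasDerivAt
      (fun y => lam / 2 * k * (s * y - r) ^ 2 - (a * (s * y) + b))
      (lam * k * (x - s * r) - a * s) x := fun s k hs => by
    have h := (((hasDerivAt_id x).const_mul s).sub_const r).pow 2
    have h' := (h.const_mul (lam / 2 * k)).sub
      ((((hasDerivAt_id x).const_mul s).const_mul a).add_const b)
    refine h'.congr_deriv ?_
    simp only [id]
    linear_combination (lam * k * x) * hs
  rcases lt_or_ge x 0 with h0 | h0
  · have hlt : ∀ᶠ y in 𝓝[>] x, y < 0 := mem_nhdsWithin_of_mem_nhds (Iio_mem_nhds h0)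
    rcases lt_or_ge x (-r) with h1 | h1
    · have hlt' : ∀ᶠ y in 𝓝[>] x, y < -r := mem_nhdsWithin_of_mem_nhds (Iio_mem_nhds h1)
      have hx : ∀ y, y < 0 → y < -r → truncJumpDual lam a b r y =
          lam / 2 * 1 * (-1 * y - r) ^ 2 - (a * (-1 * y) + b) := fun y hy hy' => by
        rw [truncJumpDual, abs_of_neg hy, max_eq_left (by linarith)]; ring
      refine (((key (-1) 1 (by norm_num)).hasDerivWithinAt).congr_of_eventuallyEq
        ?_ (hx x h0 h1)).congr_deriv ?_
      · filter_upwards [hlt, hlt'] with y hy hy' using hx y hy hy'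
      · rw [truncJump, if_pos h0, min_eq_left (by linarith), max_eq_left h1.le]; ring
    · have hx : ∀ y, y < 0 → -r ≤ y → truncJumpDual lam a b r y =
          lam / 2 * 0 * (-1 * y - r) ^ 2 - (a * (-1 * y) + b) := fun y hy hy' => by
        rw [truncJumpDual, abs_of_neg hy, max_eq_right (by linarith)]; ring
      refine (((key (-1) 0 (by norm_num)).hasDerivWithinAt).congr_of_eventuallyEq
        ?_ (hx x h0 h1)).congr_deriv ?_
      · filter_upwards [hlt, self_mem_nhdsWithin] with y hy hy' using
          hx y hy (h1.trans (le_of_lt hy'))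
      · rw [truncJump, if_pos h0, min_eq_left (by linarith), max_eq_right h1]; ring
  · rcases lt_or_ge x r with h1 | h1
    · have hlt' : ∀ᶠ y in 𝓝[>] x, y < r := mem_nhdsWithin_of_mem_nhds (Iio_mem_nhds h1)
      have hx : ∀ y, 0 ≤ y → y < r → truncJumpDual lam a b r y =
          lam / 2 * 0 * (1 * y - r) ^ 2 - (a * (1 * y) + b) := fun y hy hy' => by
        rw [truncJumpDual, abs_of_nonneg hy, max_eq_right (by linarith)]; ring
      refine (((key 1 0 (by norm_num)).hasDerivWithinAt).congr_of_eventuallyEq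
        ?_ (hx x h0 h1)).congr_deriv ?_
      · filter_upwards [hlt', self_mem_nhdsWithin] with y hy hy' using
          hx y (h0.trans (le_of_lt hy')) hy
      · rw [truncJump, if_neg (not_lt.2 h0), min_eq_left h1.le, max_eq_right (by linarith)]; ring
    · have hx : ∀ y, 0 ≤ y → r ≤ y → truncJumpDual lam a b r y =
          lam / 2 * 1 * (1 * y - r) ^ 2 - (a * (1 * y) + b) := fun y hy hy' => by
        rw [truncJumpDual, abs_of_nonneg hy, max_eq_left (by linarith)]; ring
      refine (((key 1 1 (by norm_num)).hasDerivWithinAt).congr (fun y hy =>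
        hx y (h0.trans (le_of_lt hy)) (h1.trans (le_of_lt hy))) (hx x h0 h1)).congr_deriv ?_
      rw [truncJump, if_neg (not_lt.2 h0), min_eq_right h1, max_eq_right (by linarith)]; ring

theorem integral_sub_truncJump {L : ℝ} (hlam : 0 ≤ lam) (ha : 0 ≤ a) (hr : 0 ≤ r) (hrL : r < L)
    (hb : lam / 2 * (L - r) ^ 2 = a * L + b) {x : ℝ} (hx : -L ≤ x) :
    ∫ t in (-L)..x, (lam * t - truncJump lam a r t) = truncJumpDual lam a b r x := by
  have hL : 0 < L := hr.trans_lt hrL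
  rw [intervalIntegral.integral_eq_sub_of_hasDeriv_right_of_le hx
    (f := truncJumpDual lam a b r) _ fun x _ => hasDerivWithinAt_truncJumpDual hr x]
  · have : truncJumpDual lam a b r (-L) = 0 := by
      rw [truncJumpDual, abs_neg, abs_of_pos hL, max_eq_left (by linarith), hb, sub_self]
    rw [this, sub_zero]
  · refine (Continuous.intervalIntegrable (by fun_prop) _ _).sub ?_
    rw [intervalIntegrable_iff_integrableOn_Ioc_of_le hx]
    exact (memLp_truncJump hlam ha hr).integrable le_rfl
  · unfold truncJumpDual
    fun_prop

/-! ### Optimality conditions for the family and the three cases -/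

/-- With the weight `mu * |x| + c` and the datum `lam * x`, the truncation with a jump is the unique
solution as soon as its parameters satisfy the optimality conditions. -/
theorem isSolution_iff_ae_eq_truncJump {L mu c : ℝ} (hlam : 0 < lam) (ha : 0 ≤ a) (hamu : a ≤ mu)
    (hb0 : 0 ≤ b) (hbc : b ≤ c) (hr : 0 ≤ r) (hrL : r < L)
    (hb : lam / 2 * (L - r) ^ 2 = a * L + b) (h1 : 0 < r → a = mu) (h2 : 0 < r ∨ 0 < a → b = c)
    (w : ℝ → ℝ) :
    IsSolution (Ioo (-L) L) (fun x => lam * x) (fun x => mu * |x| + c) w ↔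
      w =ᵐ[volume.restrict (Ioo (-L) L)] truncJump lam a r := by
  have hL : 0 < L := hr.trans_lt hrL
  refine isSolution_iff_of_dual_certificate hL (p := truncJumpDual lam a b r)
    (m := truncJumpDeriv lam a r) ?_ (memLp_truncJump hlam.le ha hr) ?_ (fun x => ?_)
    (isDistribDeriv_truncJump hlam.le ha hr hrL) ?_ (fun x hx => ?_) (fun x hx => ?_) ?_ w
  · refine MemLp.of_bound (by fun_prop) (lam * L) ((ae_restrict_mem measurableSet_Ioo).mono ?_)
    intro x hx
    rw [norm_mul, Real.norm_of_nonneg hlam.le]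
    exact mul_le_mul_of_nonneg_left (abs_lt.2 hx).le hlam.le
  · refine Integrable.of_bound (by fun_prop) (mu * r + c) (ae_truncJumpDeriv ?_ fun _ => ?_)
    · intro x hx
      have := (abs_lt.2 hx).le
      rw [Real.norm_of_nonneg (by nlinarith [abs_nonneg x])]
      nlinarith
    · rw [Real.norm_of_nonneg (by simp; linarith)]
      simp; nlinarith
  · have := abs_nonneg x; nlinarith
  · rw [← integral_Ioc_eq_integral_Ioo, ← intervalIntegral.integral_of_le (by linarith),
      integral_sub_truncJump hlam.le ha hr hrL hb (by linarith), truncJumpDual, abs_of_pos hL,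
      max_eq_left (by linarith), hb, sub_self]
  · exact (integral_sub_truncJump hlam.le ha hr hrL hb hx.1.le).symm
  · have hxL : |x| < L := abs_lt.2 hx
    have hx0 := abs_nonneg x
    have hsq : 0 ≤ lam / 2 * max (|x| - r) 0 ^ 2 := by positivity
    have hle : truncJumpDual lam a b r x ≤ 0 := by
      rw [truncJumpDual]
      rcases le_total (|x|) r with h | h
      · rw [max_eq_right (by linarith)]; nlinarith
      · rw [max_eq_left (by linarith)]
        -- With `t` the relative position of `|x|` in `[r, L]`, the square term is `t² (a L + b) ≤ t
        -- (a L + b) ≤ a|x| + b`, as `t L ≤ |x|`.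
        obtain ⟨t, ht0, ht1, ht⟩ : ∃ t, 0 ≤ t ∧ t ≤ 1 ∧ |x| - r = t * (L - r) :=
          ⟨(|x| - r) / (L - r), div_nonneg (by linarith) (by linarith),
            (div_le_one (by linarith)).2 (by linarith), (div_mul_cancel₀ _ (by linarith)).symm⟩
        have e1 : lam / 2 * (|x| - r) ^ 2 = t ^ 2 * (a * L + b) := by rw [ht, ← hb]; ring
        have e2 : t ^ 2 * (a * L + b) ≤ t * (a * L + b) :=
          mul_le_mul_of_nonneg_right (by nlinarith) (by positivity)
        have e3 : t * L ≤ |x| := by nlinarith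
        nlinarith [mul_le_mul_of_nonneg_left e3 ha, mul_nonneg (sub_nonneg.2 ht1) hb0]
    rw [abs_of_nonpos hle, truncJumpDual]
    nlinarith
  · refine ae_truncJumpDeriv (fun x hx => ?_) fun ha' => ?_
    · have hr0 : 0 < r := by linarith [hx.1, hx.2]
      rw [truncJumpDual, max_eq_right (by linarith [abs_lt.2 hx]), h1 hr0, h2 (Or.inl hr0)]
      ring
    · rw [truncJumpDual, abs_zero, max_eq_right (by linarith), h2 (Or.inr ha')]
      ring

end WeightedTV

theorem proposition3p13 (L lam mu c : ℝ) (hL : 0 < L) (hlam : 0 < lam) (hmu : 0 < mu)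
    (hc : 0 < c) :
    (mu * L + c < lam * L ^ 2 / 2 →
      ∀ x₀ : ℝ, x₀ = L - √(2 * lam * mu * L + 2 * lam * c) / lam →
      ∀ u : ℝ → ℝ,
        WeightedTV.IsSolution (Ioo (-L) L) (fun x => lam * x) (fun x => mu * |x| + c) u ↔
          u =ᵐ[volume.restrict (Ioo (-L) L)] fun x =>
            if x ≤ -x₀ then -(lam * x₀) - mu
            else if x < 0 then lam * x - mu
            else if x < x₀ then lam * x + mu
            else lam * x₀ + mu) ∧
    (lam * L ^ 2 / 2 ≤ mu * L + c → c < lam * L ^ 2 / 2 →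
      ∀ u : ℝ → ℝ,
        WeightedTV.IsSolution (Ioo (-L) L) (fun x => lam * x) (fun x => mu * |x| + c) u ↔
          u =ᵐ[volume.restrict (Ioo (-L) L)] fun x =>
            if x < 0 then -(lam * L / 2) + c / L else lam * L / 2 - c / L) ∧
    (lam * L ^ 2 / 2 ≤ c →
      ∀ u : ℝ → ℝ,
        WeightedTV.IsSolution (Ioo (-L) L) (fun x => lam * x) (fun x => mu * |x| + c) u ↔
          u =ᵐ[volume.restrict (Ioo (-L) L)] fun _ => 0) := by

  refine ⟨fun h x₀ hx₀ u => ?_, fun h h' u => ?_, fun h u => ?_⟩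
  · set s := √(2 * lam * mu * L + 2 * lam * c) with hs
    have hs2 : s ^ 2 = 2 * lam * mu * L + 2 * lam * c := Real.sq_sqrt (by positivity)
    have hs0 : 0 < s := Real.sqrt_pos.2 (by positivity)
    have hsL : s < lam * L := by
      -- Squared, this is the case hypothesis `mu * L + c < lam * L ^ 2 / 2`; it amounts to `x₀ >
      -- 0`.
      refine lt_of_pow_lt_pow_left₀ 2 (by positivity) ?_
      rw [hs2]
      nlinarith
    have hx0 : 0 < x₀ := by
      rw [hx₀, sub_pos, div_lt_iff₀ hlam]; linarith
    have hxL : x₀ < L := by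
      rw [hx₀]; linarith [div_pos hs0 hlam]
    have hb : lam / 2 * (L - x₀) ^ 2 = mu * L + c := by
      rw [hx₀, sub_sub_cancel, div_pow, hs2]
      field_simp
    rw [WeightedTV.isSolution_iff_ae_eq_truncJump hlam hmu.le le_rfl hc.le le_rfl hx0.le hxL hb
      (fun _ => rfl) (fun _ => rfl)]
    have : WeightedTV.truncJump lam mu x₀ = fun x =>
        if x ≤ -x₀ then -(lam * x₀) - mu
        else if x < 0 then lam * x - mu
        else if x < x₀ then lam * x + mu
        else lam * x₀ + mu := by
      ext x
      rw [WeightedTV.truncJump]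
      split_ifs with h1 h2 h3 h4
      · rw [min_eq_left (by linarith), max_eq_left h2]; ring
      · rw [min_eq_left (by linarith), max_eq_right (by linarith)]; ring
      · linarith
      · rw [min_eq_left h4.le, max_eq_right (by linarith)]; ring
      · rw [min_eq_right (by linarith), max_eq_right (by linarith)]; ring
    rw [this]
  · have hb : lam / 2 * (L - 0) ^ 2 = (lam * L / 2 - c / L) * L + c := by
      field_simp
      ring
    have ha : 0 < lam * L / 2 - c / L := by
      rw [sub_pos, div_lt_iff₀ hL]; linarith
    have hamu : lam * L / 2 - c / L ≤ mu := by
      refine le_of_mul_le_mul_right ?_ hL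
      linarith
    rw [WeightedTV.isSolution_iff_ae_eq_truncJump hlam ha.le hamu hc.le le_rfl le_rfl hL hb
      (fun h0 => absurd h0 (lt_irrefl _)) (fun _ => rfl)]
    have : WeightedTV.truncJump lam (lam * L / 2 - c / L) 0 = fun x =>
        if x < 0 then -(lam * L / 2) + c / L else lam * L / 2 - c / L := by
      ext x
      rw [WeightedTV.truncJump, neg_zero, max_eq_left (min_le_right _ _)]
      split_ifs <;> ring
    rw [this]
  · rw [WeightedTV.isSolution_iff_ae_eq_truncJump (a := 0) (b := lam * L ^ 2 / 2) hlam le_rfl hmu.le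
      (by positivity) h le_rfl hL (by ring) (fun h0 => absurd h0 (lt_irrefl _))
      (fun h0 => absurd h0 (by simp))]
    have : WeightedTV.truncJump lam 0 0 = fun _ => 0 := by
      ext x
      rw [WeightedTV.truncJump, neg_zero, max_eq_left (min_le_right _ _)]
      ring
    rw [this]
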